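/- Let $V$ denote the ground model. A forcing notion is a preordered set $\mathbb P$, where the stronger condition is the greater one; $p,q\in\mathbb P$ are compatible if some $r\in\mathbb P$ satisfies $p\le r$ and $q\le r$, and $\mathbb P$ is ccc if every set of pairwise incompatible conditions is countable. Let $\mathrm{cov}(\mathcal M)$ be the least cardinality of a family of meager sets of reals whose union contains all the reals. A real $f\in\omega^\omega$ of a generic extension of $V$ is unbounded over $V$ if for no $g\in\omega^\omega\cap V$ we have $f(n)\le g(n)$ for all but finitely many $n$; a real $c\in 2^\omega$ of the extension is a Cohen real over $V$ if for every dense set $D\subseteq 2^{<\omega}$ with $D\in V$, some initial segment of $c$ belongs to $D$. **Theorem.** Let $\mathbb P$ be a ccc forcing notion with $|\mathbb P|<\mathrm{cov}(\mathcal M)$, and suppose that $$\Vdash_{\mathbb P}\text{``there is an unbounded real over }V\text{''}.$$ Then $$\Vdash_{\mathbb P}\text{``there is a Cohen real over }V\text{''}.$$ -/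

import Mathlib

universe u

namespace Forcing

section Order

variable {P : Type u} [Preorder P]

/-- Two conditions are compatible if they have a common strengthening.
The stronger condition is the greater one. -/
def Compatible (p q : P) : Prop := ∃ r, p ≤ r ∧ q ≤ r

/-- The countable chain condition: every set of pairwise incompatible conditions is countable. -/
def CCC (P : Type u) [Preorder P] : Prop :=
  ∀ A : Set P, (∀ p ∈ A, ∀ q ∈ A, p ≠ q → ¬ Compatible p q) → A.Countable

/-- `D` is dense above `p`. -/
def DenseAbove (D : P → Prop) (p : P) : Prop := ∀ q, p ≤ q → ∃ r, q ≤ r ∧ D r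

end Order

/-- `P`-names over the ground model `V = PSet.{u}`: a name is a set (indexed by a type of `V`)
of pairs `(σ, p)`, where `σ` is a name and `p` is a condition. -/
inductive PName (P : Type u) : Type (u + 1)
  | mk (ι : Type u) (name : ι → PName P) (cond : ι → P) : PName P

/-- The canonical name `x̌ = {(y̌, p) : y ∈ x, p ∈ P}` of a set `x` of the ground model. -/
def check (P : Type u) : PSet.{u} → PName P
  | PSet.mk α A => PName.mk (α × P) (fun a => check P (A a.1)) (fun a => a.2)

section Relation

variable {P : Type u} [Preorder P]

/-- `forcesEq σ τ p` is `p ⊩ σ = τ`: for all `(π, s) ∈ σ`, every `q ≥ p, s` forces `π ∈ τ`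
(see `forcesMem`), and symmetrically. -/
def forcesEq : PName P → PName P → P → Prop
  | PName.mk ι a s, PName.mk κ b t => fun p =>
    (∀ i : ι, ∀ q, p ≤ q → s i ≤ q →
      DenseAbove (fun r => ∃ j : κ, t j ≤ r ∧ forcesEq (a i) (b j) r) q) ∧
    (∀ j : κ, ∀ q, p ≤ q → t j ≤ q →
      DenseAbove (fun r => ∃ i : ι, s i ≤ r ∧ forcesEq (a i) (b j) r) q)

/-- `forcesMem π τ p` is `p ⊩ π ∈ τ`: the set of `r` such that `r ⊩ π = σ` for some
`(σ, t) ∈ τ` with `t ≤ r` is dense above `p`. -/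
def forcesMem (π : PName P) : PName P → P → Prop
  | PName.mk κ b t => DenseAbove (fun r => ∃ j : κ, t j ≤ r ∧ forcesEq π (b j) r)

/-! A statement of the forcing language is represented by the set of conditions that force it.
The following are the usual clauses of the forcing relation for the logical connectives. The
index type of a quantifier is `PName P` for a quantifier over the extension; for a quantifier
that is bounded by (the canonical name of) a ground model set or by the class `V`, it is that
set or the relevant part of `V`. -/

def fNot (φ : P → Prop) (p : P) : Prop := ∀ q, p ≤ q → ¬ φ q

def fAnd (φ ψ : P → Prop) (p : P) : Prop := φ p ∧ ψ p

def fImp (φ ψ : P → Prop) : P → Prop := fNot (fAnd φ (fNot ψ))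

def fAll {ι : Sort*} (φ : ι → P → Prop) (p : P) : Prop := ∀ i, φ i p

def fEx {ι : Sort*} (φ : ι → P → Prop) : P → Prop := DenseAbove (fun q => ∃ i, φ i q)

/-- Every condition forces `φ`. -/
def Forced (φ : P → Prop) : Prop := ∀ p, φ p

/-- The Kuratowski pair `(n, m)` of two natural numbers, as a set of the ground model. -/
def natPair (n m : ℕ) : PSet.{u} :=
  {{PSet.ofNat n}, {PSet.ofNat n, PSet.ofNat m}}

/-- The statement `f(n) = m`, that is, `(n, m) ∈ f`. -/
def fVal (f : PName P) (n m : ℕ) : P → Prop := forcesMem (check P (natPair n m)) f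

/-- The statement `f` is a function from `ω` to `Y`, where `Y` is a subset of `ω` in the ground
model: every element of `f` is a pair `(n, m)` with `m ∈ Y`, every `n` has a value, and values
are unique. -/
def fIsFun (f : PName P) (Y : Set ℕ) : P → Prop :=
  fAnd
    (fAll fun x : PName P => fImp (forcesMem x f)
      (fEx fun n : ℕ => fEx fun m : Y => forcesEq x (check P (natPair n m))))
    (fAnd
      (fAll fun n : ℕ => fEx fun m : ℕ => fVal f n m)
      (fAll fun n : ℕ => fAll fun m : ℕ => fAll fun m' : {k : ℕ // k ≠ m} =>
        fNot (fAnd (fVal f n m) (fVal f n m'))))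

/-- The statement `f` is an unbounded real over `V`: `f ∈ ω^ω`, and for no `g ∈ ω^ω ∩ V` do we
have `f(n) ≤ g(n)` for all but finitely many `n`. -/
def fUnboundedReal (f : PName P) : P → Prop :=
  fAnd (fIsFun f Set.univ)
    (fAll fun g : ℕ → ℕ => fNot
      (fEx fun k : ℕ => fAll fun n : {n : ℕ // k ≤ n} => fEx fun m : {m : ℕ // m ≤ g n} =>
        fVal f n m))

/-- `D` is a dense subset of the tree `2^{<ω}` of finite binary sequences. -/
def DenseInTree (D : Set (List (Fin 2))) : Prop := ∀ s, ∃ t ∈ D, s <+: t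

/-- The statement `c` is a Cohen real over `V`: `c ∈ 2^ω`, and every dense subset of `2^{<ω}`
that lies in `V` contains an initial segment of `c`. -/
def fCohenReal (c : PName P) : P → Prop :=
  fAnd (fIsFun c {0, 1})
    (fAll fun D : {D : Set (List (Fin 2)) // DenseInTree D} => fEx fun s : D.1 =>
      fAll fun i : Fin s.1.length => fVal c i (s.1.get i))

end Relation

/-- `cov(M)`: the least cardinality of a family of meager sets of reals (points of the Baire
space `ω^ω`) that covers all the reals. -/
noncomputable def covMeager : Cardinal.{0} :=
  sInf {κ | ∃ F : Set (Set (ℕ → ℕ)), (∀ A ∈ F, IsMeagre A) ∧ ⋃₀ F = Set.univ ∧ Cardinal.mk F = κ}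

end Forcing

namespace Forcing

/-! ### Baire category and `covMeager` -/

section Category

/-! Let `p` force `f` to be unbounded. For each `q ≥ p`, the tree of initial segments of `f`
possible below `q` has an infinitely branching node `s_q`; otherwise its levels are finite and `f`
is bounded by a ground model function (`exists_infinite_branching`). This gives at most `|P|`
infinite sets of successors `s_q ++ [m]`. A ground model map `c` from finite sequences of naturals
to finite binary sequences misses some value on a given infinite set only on a meager set of `c`, so
a single `c` takes every value on all of them (`exists_surjOn_of_card_lt_covMeager`). The
concatenation of `c (f ↾ 0), c (f ↾ 1), ...` is Cohen: given a dense `D` and `q`, some `u` extends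
the part computed from `s_q` into `D`, and a stronger condition makes `f` pass through a successor
coded by `u` (`fCohenReal_cohenName`). -/

theorem isNowhereDense_of_missed_value {J : Set ℕ} (hJ : J.Infinite) (u : ℕ) :
    IsNowhereDense {x : ℕ → ℕ | ∀ n ∈ J, x n ≠ u} := by
  have hcl : IsClosed {x : ℕ → ℕ | ∀ n ∈ J, x n ≠ u} := by
    have h : {x : ℕ → ℕ | ∀ n ∈ J, x n ≠ u} = ⋂ n ∈ J, (fun x : ℕ → ℕ => x n) ⁻¹' {u}ᶜ := by
      ext x
      simp
    rw [h]
    exact isClosed_biInter fun n _ => (isClosed_discrete _).preimage (continuous_apply n)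
  rw [hcl.isNowhereDense_iff, Set.eq_empty_iff_forall_notMem]
  intro x hx
  rw [mem_interior_iff_mem_nhds, nhds_pi, Filter.mem_pi] at hx
  obtain ⟨I, hI, t, ht, hsub⟩ := hx
  -- A basic neighbourhood restricts only the finitely many coordinates in `I`, so `x` may be
  -- changed to `u` at some `n ∈ J` outside `I`.
  obtain ⟨n, hnJ, hnI⟩ := hJ.exists_notMem_finite hI
  have hmem : Function.update x n u ∈ I.pi t := by
    intro i hi
    rw [Function.update_of_ne (ne_of_mem_of_not_mem hi hnI)]
    exact mem_of_mem_nhds (ht i)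
  exact hsub hmem n hnJ (Function.update_self n u x)

theorem isMeagre_missed_value {J : Set ℕ} (hJ : J.Infinite) :
    IsMeagre {x : ℕ → ℕ | ∃ u, ∀ n ∈ J, x n ≠ u} := by
  have h : {x : ℕ → ℕ | ∃ u, ∀ n ∈ J, x n ≠ u} = ⋃ u, {x : ℕ → ℕ | ∀ n ∈ J, x n ≠ u} := by
    ext x
    simp
  rw [h]
  exact isMeagre_iUnion fun u => (isNowhereDense_of_missed_value hJ u).isMeagre

/-- Fewer than `cov(M)` meager sets do not cover the Baire space. -/
theorem exists_notMem_of_card_lt_covMeager {κ : Type u} (A : κ → Set (ℕ → ℕ))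
    (hA : ∀ k, IsMeagre (A k)) (hκ : Cardinal.mk κ < Cardinal.lift.{u, 0} covMeager) :
    ∃ x, ∀ k, x ∉ A k := by
  by_contra! hcov
  have hle : covMeager ≤ Cardinal.mk (Set.range A) := by
    refine csInf_le' ⟨Set.range A, ?_, ?_, rfl⟩
    · rintro _ ⟨k, rfl⟩
      exact hA k
    · refine Set.eq_univ_of_forall fun x => ?_
      obtain ⟨k, hk⟩ := hcov x
      exact ⟨A k, ⟨k, rfl⟩, hk⟩
  have hrange : Cardinal.lift.{u, 0} (Cardinal.mk (Set.range A)) ≤ Cardinal.mk κ := by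
    simpa using Cardinal.mk_range_le_lift (f := A)
  exact absurd ((Cardinal.lift_le.{u, 0}.2 hle).trans hrange) (not_le.2 hκ)

/-- Given fewer than `cov(M)` infinite subsets of a countable set `α`, some function on `α` takes
every value on each of them. -/
theorem exists_surjOn_of_card_lt_covMeager {α β : Type} [Encodable α] [Encodable β] [Inhabited β]
    {κ : Type u} (J : κ → Set α) (hJ : ∀ k, (J k).Infinite)
    (hκ : Cardinal.mk κ < Cardinal.lift.{u, 0} covMeager) :
    ∃ c : α → β, ∀ k, ∀ u, ∃ s ∈ J k, c s = u := by
  obtain ⟨x, hx⟩ := exists_notMem_of_card_lt_covMeager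
    (fun k => {x : ℕ → ℕ | ∃ u, ∀ n ∈ Encodable.encode '' J k, x n ≠ u})
    (fun k => isMeagre_missed_value ((hJ k).image Encodable.encode_injective.injOn)) hκ
  -- The default is harmless: only the places where `x` is the code of `u` are used.
  refine ⟨fun s => (Encodable.decode (x (Encodable.encode s))).getD default, fun k u => ?_⟩
  have hk := hx k
  simp only [Set.mem_ofPred_eq, not_exists, not_forall, not_not] at hk
  obtain ⟨_, ⟨s, hs, rfl⟩, hsu⟩ := hk (Encodable.encode u)
  exact ⟨s, hs, by simp [hsu]⟩

end Category

/-! ### Concatenating along initial segments -/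

section Concatenation

variable {α β : Type*}

/-- The concatenation of the values of `c` at the initial segments of `s`. -/
def concatInits (c : List α → List β) (s : List α) : List β :=
  (List.range (s.length + 1)).flatMap fun i => c (s.take i)

theorem concatInits_concat (c : List α → List β) (s : List α) (a : α) :
    concatInits c (s ++ [a]) = concatInits c s ++ c (s ++ [a]) := by
  have h : ∀ i ∈ List.range (s.length + 1), c ((s ++ [a]).take i) = c (s.take i) := by
    intro i hi
    rw [List.take_append_of_le_length (by simpa [Nat.lt_succ_iff] using hi)]
  unfold concatInits
  rw [List.length_append, List.length_singleton, List.range_succ, List.flatMap_append,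
    List.flatMap_congr h, List.flatMap_singleton, List.take_of_length_le (by simp)]

theorem concatInits_prefix_append (c : List α → List β) (s t : List α) :
    concatInits c s <+: concatInits c (s ++ t) := by
  induction t using List.reverseRecOn with
  | nil => simp
  | append_singleton t a ih =>
    rw [← List.append_assoc, concatInits_concat]
    exact ih.trans (List.prefix_append _ _)

end Concatenation

/-! ### The tree of possible initial segments -/

section Decision

variable {P : Type u}

/-- The condition `q` decides the initial segment of length `s.length` of a real to be `s`, where
`v n m` is the set of conditions forcing that the `n`-th value is `m`. -/
def Decides (v : ℕ → ℕ → P → Prop) (s : List ℕ) (q : P) : Prop :=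
  ∀ i (h : i < s.length), v i s[i] q

variable {v : ℕ → ℕ → P → Prop}

theorem Decides.mono [Preorder P] (hmono : ∀ n m p q, p ≤ q → v n m p → v n m q) {s : List ℕ} {p q : P}
    (hpq : p ≤ q) (h : Decides v s p) : Decides v s q :=
  fun i hi => hmono _ _ _ _ hpq (h i hi)

theorem decides_concat {s : List ℕ} {m : ℕ} {q : P} :
    Decides v (s ++ [m]) q ↔ Decides v s q ∧ v s.length m q := by
  constructor
  · intro h
    refine ⟨fun i hi => ?_, ?_⟩
    · have := h i (by simp; omega)
      rwa [List.getElem_append_left hi] at this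
    · simpa using h s.length (by simp)
  · rintro ⟨h, hm⟩ i hi
    by_cases his : i < s.length
    · rw [List.getElem_append_left his]
      exact h i his
    · obtain rfl : i = s.length := by
        simp only [List.length_append, List.length_singleton] at hi
        omega
      simpa using hm

theorem Decides.prefix_of_length_le {s t : List ℕ} {q : P}
    (huniq : ∀ n m m', v n m q → v n m' q → m = m')
    (hs : Decides v s q) (ht : Decides v t q) (hle : s.length ≤ t.length) : s <+: t := by
  rw [List.prefix_iff_eq_take]
  refine List.ext_getElem (by simpa using hle) fun i h₁ h₂ => ?_
  rw [List.getElem_take]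
  exact huniq i _ _ (hs i h₁) (ht i (h₁.trans_le hle))

theorem exists_decides [Preorder P] (hmono : ∀ n m p q, p ≤ q → v n m p → v n m q) {p : P}
    (htot : ∀ n, DenseAbove (fun q => ∃ m, v n m q) p) (n : ℕ) :
    DenseAbove (fun q => ∃ s : List ℕ, s.length = n ∧ Decides v s q) p := by
  induction n with
  | zero => exact fun q _ => ⟨q, le_rfl, [], rfl, fun i hi => by simp at hi⟩
  | succ n ih =>
    intro q hq
    obtain ⟨r, hqr, s, hs, hsr⟩ := ih q hq
    obtain ⟨r', hrr', m, hm⟩ := htot n r (hq.trans hqr)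
    exact ⟨r', hqr.trans hrr', s ++ [m], by simp [hs],
      decides_concat.2 ⟨hsr.mono hmono hrr', hs ▸ hm⟩⟩

/-- If the tree of the initial segments that are possible for a real is finitely branching, then
the real is bounded. -/
theorem exists_bound_of_finite_branching [Preorder P]
    (hmono : ∀ n m p q, p ≤ q → v n m p → v n m q) {p : P}
    (htot : ∀ n, DenseAbove (fun q => ∃ m, v n m q) p)
    (hfin : ∀ s : List ℕ, {m | ∃ q, p ≤ q ∧ Decides v (s ++ [m]) q}.Finite) :
    ∃ g : ℕ → ℕ, ∀ n m q, p ≤ q → v n m q → m ≤ g n := by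
  have hlevel : ∀ n, {s : List ℕ | s.length = n ∧ ∃ q, p ≤ q ∧ Decides v s q}.Finite := by
    intro n
    induction n with
    | zero => exact (Set.finite_singleton []).subset fun s hs => List.length_eq_zero_iff.1 hs.1
    | succ n ih =>
      refine (ih.biUnion fun s _ => (hfin s).image fun m => s ++ [m]).subset ?_
      rintro t ⟨ht, q, hpq, hq⟩
      obtain rfl | ⟨s, m, rfl⟩ := t.eq_nil_or_concat'
      · simp at ht
      · simp only [Set.mem_iUnion]
        exact ⟨s, ⟨by simpa using ht, q, hpq, (decides_concat.1 hq).1⟩, m, ⟨q, hpq, hq⟩, rfl⟩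
  have hval : ∀ n, {m | ∃ q, p ≤ q ∧ v n m q}.Finite := by
    intro n
    refine ((hlevel n).biUnion fun s _ => hfin s).subset ?_
    rintro m ⟨q, hpq, hm⟩
    obtain ⟨r, hqr, s, hs, hsr⟩ := exists_decides hmono htot n q hpq
    simp only [Set.mem_iUnion]
    exact ⟨s, ⟨hs, r, hpq.trans hqr, hsr⟩, r, hpq.trans hqr,
      decides_concat.2 ⟨hsr, hs ▸ hmono _ _ _ _ hqr hm⟩⟩
  choose g hg using fun n => (hval n).bddAbove
  exact ⟨g, fun n m q hpq hm => hg n ⟨q, hpq, hm⟩⟩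

end Decision

/-! ### Monotonicity of forcing and canonical names -/

section CheckNames

theorem mk_ofNat_injective : Function.Injective fun n => ZFSet.mk (PSet.ofNat.{u} n) := by
  have hmem : ∀ m n, n < m → ZFSet.mk (PSet.ofNat.{u} n) ∈ ZFSet.mk (PSet.ofNat.{u} m) := by
    intro m
    induction m with
    | zero => exact fun n hn => absurd hn (Nat.not_lt_zero n)
    | succ m ih =>
      intro n hn
      change _ ∈ ZFSet.mk (insert (PSet.ofNat m) (PSet.ofNat m))
      change _ ∈ insert (ZFSet.mk (PSet.ofNat m)) (ZFSet.mk (PSet.ofNat m))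
      rw [ZFSet.mem_insert_iff]
      rcases Nat.lt_succ_iff_lt_or_eq.1 hn with h | rfl
      · exact Or.inr (ih n h)
      · exact Or.inl rfl
  intro a b hab
  by_contra hne
  rcases Nat.lt_or_gt_of_ne hne with h | h
  · exact ZFSet.mem_irrefl _ ((congrArg (_ ∈ ·) hab).mpr (hmem b a h))
  · exact ZFSet.mem_irrefl _ ((congrArg (_ ∈ ·) hab).mp (hmem a b h))

theorem natPair_equiv_iff {n m n' m' : ℕ} :
    (natPair.{u} n m).Equiv (natPair.{u} n' m') ↔ n = n' ∧ m = m' := by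
  refine ⟨fun h => ?_, by rintro ⟨rfl, rfl⟩; exact PSet.Equiv.refl _⟩
  have h' : ZFSet.pair (ZFSet.mk (PSet.ofNat.{u} n)) (ZFSet.mk (PSet.ofNat m)) =
      ZFSet.pair (ZFSet.mk (PSet.ofNat n')) (ZFSet.mk (PSet.ofNat m')) := Quotient.sound (s := PSet.setoid) h
  obtain ⟨h₁, h₂⟩ := ZFSet.pair_inj.1 h'
  exact ⟨mk_ofNat_injective h₁, mk_ofNat_injective h₂⟩

variable {P : Type u} [Preorder P]

theorem DenseAbove.mono {D : P → Prop} {p q : P} (hpq : p ≤ q) (h : DenseAbove D p) :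
    DenseAbove D q :=
  fun r hr => h r (hpq.trans hr)

theorem forcesEq_mono {σ τ : PName P} {p q : P} (hpq : p ≤ q) (h : forcesEq σ τ p) :
    forcesEq σ τ q := by
  cases σ
  cases τ
  rw [forcesEq] at h ⊢
  exact ⟨fun i r hr => h.1 i r (hpq.trans hr), fun j r hr => h.2 j r (hpq.trans hr)⟩

theorem forcesMem_mono {π τ : PName P} {p q : P} (hpq : p ≤ q) (h : forcesMem π τ p) :
    forcesMem π τ q := by
  cases τ
  exact DenseAbove.mono hpq h

theorem forcesEq_check_self (x : PSet.{u}) (p : P) : forcesEq (check P x) (check P x) p := by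
  induction x generalizing p with
  | mk α A ih =>
    rw [check, forcesEq]
    exact ⟨fun i q _ hi r hr => ⟨r, le_rfl, i, hi.trans hr, ih _ _⟩,
      fun i q _ hi r hr => ⟨r, le_rfl, i, hi.trans hr, ih _ _⟩⟩

theorem equiv_of_forcesEq_check {x y : PSet.{u}} {p : P}
    (h : forcesEq (check P x) (check P y) p) : x.Equiv y := by
  induction x generalizing y p with
  | mk α A ih =>
    cases y with
    | mk β B =>
      rw [check, check, forcesEq] at h
      refine ⟨fun a => ?_, fun b => ?_⟩
      -- A canonical name pairs each element with every condition, in particular with `p` itself.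
      · obtain ⟨r, _, j, _, hj⟩ := h.1 (a, p) p le_rfl le_rfl p le_rfl
        exact ⟨j.1, ih _ hj⟩
      · obtain ⟨r, _, i, _, hi⟩ := h.2 (b, p) p le_rfl le_rfl p le_rfl
        exact ⟨i.1, ih _ hi⟩

end CheckNames

/-! ### Names for functions given by their graphs -/

section PartialFunction

variable {P : Type u} [Preorder P]

/-- The name `{((n, m)ˇ, q) : R n m q}`. -/
def graphName (R : ℕ → ℕ → P → Prop) : PName P :=
  PName.mk {a : ℕ × ℕ × P // R a.1 a.2.1 a.2.2} (fun a => check P (natPair a.1.1 a.1.2.1))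
    (fun a => a.1.2.2)

variable {R : ℕ → ℕ → P → Prop}

theorem fVal_graphName {n m : ℕ} {q : P} (h : R n m q) : fVal (graphName R) n m q :=
  fun r hr => ⟨r, le_rfl, ⟨(n, m, q), h⟩, hr, forcesEq_check_self _ _⟩

theorem exists_of_fVal_graphName {n m : ℕ} {q : P} (h : fVal (graphName R) n m q) :
    ∃ r, q ≤ r ∧ ∃ t, t ≤ r ∧ R n m t := by
  obtain ⟨r, hqr, ⟨⟨n', m', t⟩, ht⟩, htr, heq⟩ := h q le_rfl
  obtain ⟨rfl, rfl⟩ := natPair_equiv_iff.1 (equiv_of_forcesEq_check heq)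
  exact ⟨r, hqr, t, htr, ht⟩

theorem fIsFun_graphName {Y : Set ℕ} {p : P} (hY : ∀ n m q, R n m q → m ∈ Y)
    (htot : ∀ n, DenseAbove (fun q => ∃ m, R n m q) p)
    (huniq : ∀ n m m' t t' q, p ≤ q → t ≤ q → t' ≤ q → R n m t → R n m' t' → m = m') :
    fIsFun (graphName R) Y p := by
  refine ⟨?_, ?_, ?_⟩
  · rintro x q - ⟨hx, hno⟩
    obtain ⟨r, hqr, ⟨⟨n, m, t⟩, ht⟩, htr, heq⟩ := hx q le_rfl
    exact hno r hqr fun r' hr' => ⟨r', le_rfl, n, fun r'' hr'' => ⟨r'', le_rfl, ⟨m, hY _ _ _ ht⟩,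
      forcesEq_mono (hr'.trans hr'') heq⟩⟩
  · intro n q hq
    obtain ⟨r, hqr, m, hm⟩ := htot n q hq
    exact ⟨r, hqr, m, fVal_graphName hm⟩
  · rintro n m ⟨m', hne⟩ q hpq ⟨h, h'⟩
    obtain ⟨r, hqr, t, htr, ht⟩ := exists_of_fVal_graphName h
    obtain ⟨r', hrr', t', htr', ht'⟩ := exists_of_fVal_graphName (forcesMem_mono hqr h')
    exact hne (huniq n m m' t t' r' (hpq.trans (hqr.trans hrr')) (htr.trans hrr') htr' ht ht').symm

end PartialFunction

/-! ### The Cohen real -/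

section Cohen

variable {P : Type u} [Preorder P]

/-- The name of the real obtained from the real `f` by concatenating the values of `c` at the
initial segments of `f`. -/
def cohenName (f : PName P) (c : List ℕ → List (Fin 2)) : PName P :=
  graphName fun n b q => ∃ s, Decides (fVal f) s q ∧ (concatInits c s)[n]?.map Fin.val = some b

theorem fVal_mono (f : PName P) (n m : ℕ) (p q : P) (hpq : p ≤ q) (h : fVal f n m p) :
    fVal f n m q :=
  forcesMem_mono hpq h

theorem fVal_unique {f : PName P} {Y : Set ℕ} {p q : P} (hf : fIsFun f Y p) (hpq : p ≤ q)
    (n m m' : ℕ) (h : fVal f n m q) (h' : fVal f n m' q) : m = m' := by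
  by_contra hne
  exact hf.2.2 n m ⟨m', fun h => hne h.symm⟩ q hpq ⟨h, h'⟩

theorem fIsFun.total {f : PName P} {Y : Set ℕ} {p : P} (hf : fIsFun f Y p) (n : ℕ) :
    DenseAbove (fun q => ∃ m, fVal f n m q) p :=
  hf.2.1 n

/-- Below a condition forcing `f` to be unbounded, the tree of possible initial segments of `f`
has an infinitely branching node. -/
theorem exists_infinite_branching {f : PName P} {p q : P} (hf : fUnboundedReal f p)
    (hpq : p ≤ q) :
    ∃ s : List ℕ, {m | ∃ r, q ≤ r ∧ Decides (fVal f) (s ++ [m]) r}.Infinite := by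
  by_contra! hfin
  have htot : ∀ n, DenseAbove (fun r => ∃ m, fVal f n m r) q :=
    fun n => (hf.1.total n).mono hpq
  obtain ⟨g, hg⟩ := exists_bound_of_finite_branching (fVal_mono f) htot
    hfin
  -- The bound `g` holds at every `n`, so the threshold is `0`.
  refine hf.2 g q hpq fun r hqr => ⟨r, le_rfl, 0, fun n r' hr' => ?_⟩
  obtain ⟨r'', hr'', m, hm⟩ := htot n r' (hqr.trans hr')
  exact ⟨r'', hr'', ⟨m, hg n m r'' (hqr.trans (hr'.trans hr'')) hm⟩, hm⟩

/-- Passing from `s` to `s ++ [m]` appends exactly `c (s ++ [m])`, which `hc` allows to be any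
prescribed `u`; hence every dense set is met densely above `p` (`hgen`). -/
theorem fCohenReal_cohenName {f : PName P} {Y : Set ℕ} {p : P} (hf : fIsFun f Y p)
    {c : List ℕ → List (Fin 2)}
    (hc : ∀ q, p ≤ q → ∃ s : List ℕ, ∀ u, ∃ m r, q ≤ r ∧ Decides (fVal f) (s ++ [m]) r ∧
      c (s ++ [m]) = u) :
    fCohenReal (cohenName f c) p := by
  have hgen : ∀ D, DenseInTree D →
      DenseAbove (fun q => ∃ s, Decides (fVal f) s q ∧ concatInits c s ∈ D) p := by
    intro D hD q hpq
    obtain ⟨s, hs⟩ := hc q hpq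
    obtain ⟨_, htD, u, rfl⟩ := hD (concatInits c s)
    obtain ⟨m, r, hqr, hr, hu⟩ := hs u
    exact ⟨r, hqr, s ++ [m], hr, by rwa [concatInits_concat, hu]⟩
  refine ⟨fIsFun_graphName ?_ ?_ ?_, ?_⟩
  · rintro n b q ⟨s, -, hb⟩
    obtain ⟨a, -, rfl⟩ := Option.map_eq_some_iff.1 hb
    fin_cases a <;> simp
  -- Totality is also genericity: the sequences longer than `n` are dense.
  · intro n q hpq
    obtain ⟨r, hqr, s, hs, hlen⟩ := hgen {t | n < t.length}
      (fun s => ⟨s ++ List.replicate (n + 1) 0, by simp; omega, List.prefix_append _ _⟩) q hpq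
    exact ⟨r, hqr, _, s, hs, by rw [List.getElem?_eq_getElem hlen]; rfl⟩
  · rintro n b b' t t' q hpq ht ht' ⟨s, hs, hb⟩ ⟨s', hs', hb'⟩
    have hs := hs.mono (fVal_mono f) ht
    have hs' := hs'.mono (fVal_mono f) ht'
    have huniq := fVal_unique hf hpq
    -- Initial segments decided by one condition are comparable, and the longer one only lengthens
    -- the concatenation.
    have key : ∀ {s s' : List ℕ} {b b' : ℕ}, s <+: s' →
        (concatInits c s)[n]?.map Fin.val = some b →
        (concatInits c s')[n]?.map Fin.val = some b' → b = b' := by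
      rintro s _ b b' ⟨t, rfl⟩ hb hb'
      obtain ⟨a, ha, rfl⟩ := Option.map_eq_some_iff.1 hb
      obtain ⟨w, hw⟩ := concatInits_prefix_append c s t
      obtain ⟨hlt, -⟩ := List.getElem?_eq_some_iff.1 ha
      rw [← hw, List.getElem?_append_left hlt, ha] at hb'
      simpa using hb'
    rcases le_total s.length s'.length with h | h
    · exact key (hs.prefix_of_length_le huniq hs' h) hb hb'
    · exact (key (hs'.prefix_of_length_le huniq hs h) hb' hb).symm
  · rintro ⟨D, hD⟩ q hpq
    obtain ⟨r, hqr, s, hs, hsD⟩ := hgen D hD q hpq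
    exact ⟨r, hqr, ⟨_, hsD⟩, fun i => fVal_graphName ⟨s, hs, by simp⟩⟩

theorem exists_fCohenReal_of_fUnboundedReal
    (hcard : Cardinal.mk P < Cardinal.lift.{u, 0} covMeager) {f : PName P} {p : P}
    (hf : fUnboundedReal f p) : ∃ c : PName P, fCohenReal c p := by
  choose s hs using fun q : Set.Ici p => exists_infinite_branching hf q.2
  obtain ⟨c, hc⟩ := exists_surjOn_of_card_lt_covMeager (β := List (Fin 2))
    (fun q : Set.Ici p => (fun m => s q ++ [m]) ''
      {m | ∃ r, q.1 ≤ r ∧ Decides (fVal f) (s q ++ [m]) r})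
    (fun q => (hs q).image fun a _ b _ h => by simpa using h)
    ((Cardinal.mk_set_le _).trans_lt hcard)
  refine ⟨cohenName f c, fCohenReal_cohenName hf.1 fun q hpq => ⟨s ⟨q, hpq⟩, fun u => ?_⟩⟩
  obtain ⟨_, ⟨m, ⟨r, hqr, hr⟩, rfl⟩, hu⟩ := hc ⟨q, hpq⟩ u
  exact ⟨m, r, hqr, hr, hu⟩

end Cohen

end Forcing

theorem mainTheorem4 (P : Type u) [Preorder P] (hccc : Forcing.CCC P)
    (hcard : Cardinal.mk P < Cardinal.lift.{u, 0} Forcing.covMeager)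
    (hunb : Forcing.Forced (Forcing.fEx fun f : Forcing.PName P => Forcing.fUnboundedReal f)) :
    Forcing.Forced (Forcing.fEx fun c : Forcing.PName P => Forcing.fCohenReal c) := by
  intro p q hpq
  obtain ⟨r, hqr, f, hf⟩ := hunb p q hpq
  exact ⟨r, hqr, Forcing.exists_fCohenReal_of_fUnboundedReal hcard hf⟩
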